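/- **Theorem (certifiable lower bound of the Wigner negativity volume).** Let $\rho$ be a density operator (positive, trace one) on the Hilbert space $L^2(\mathbb R^M)$ of $M$ bosonic modes with annihilation operators $a_m=(x_m+\partial_m)/\sqrt2$. For $\vec\xi\in\mathbb C^M$ let $D(\vec\xi)=\exp\big(\sum_{m=1}^M(\xi_m a_m^\dagger-\xi_m^* a_m)\big)$ be the displacement operator, i.e. $(D(\vec\xi)\psi)(x)=e^{i\sum_m(\sqrt2\,\mathrm{Im}\,\xi_m\,x_m-\mathrm{Re}\,\xi_m\,\mathrm{Im}\,\xi_m)}\,\psi(x-\sqrt2\,\mathrm{Re}\,\vec\xi)$. Let $$W_\rho(\vec\alpha)=\Big(\frac2\pi\Big)^M\operatorname{tr}\big[\rho\,D(\vec\alpha)\,\Pi\,D(\vec\alpha)^\dagger\big],\qquad (\Pi\psi)(x)=\psi(-x),$$ be the Wigner function of $\rho$, a real function on $\mathbb C^M$, and let $$\mathcal N_V(\rho)=\frac12\int_{\mathbb C^M}\big(|W_\rho(\vec\alpha)|-W_\rho(\vec\alpha)\big)\,d^{2M}\vec\alpha\in[0,\infty],\qquad d^{2M}\vec\alpha=\prod_m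 d\,\mathrm{Re}\,\alpha_m\,d\,\mathrm{Im}\,\alpha_m,$$ be its Wigner negativity volume. Let $N\ge1$, let $\Xi=(\vec\xi_1,\dots,\vec\xi_N)$ be any points of $\mathbb C^M$, and let $\mathbf C(\rho,\Xi)$ be the $N\times N$ matrix with entries $$[\mathbf C(\rho,\Xi)]_{j,k}=\frac1N\operatorname{tr}\big[\rho\,D(\vec\xi_j-\vec\xi_k)\big].$$ Then $\mathbf C(\rho,\Xi)$ is Hermitian, so that it has a smallest eigenvalue $\lambda_-$, and $\mathcal N_C(\rho,\Xi):=\max(0,-\lambda_-)$ satisfies $$\mathcal N_C(\rho,\Xi)\le\mathcal N_V(\rho).$$ -/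

import Mathlib

open MeasureTheory
open scoped ENNReal

noncomputable section

namespace WignerNeg

/-! ### Trace and density operators on a complex Hilbert space -/

section Trace

variable (E : Type*) [NormedAddCommGroup E] [InnerProductSpace ℂ E] [CompleteSpace E]

/-- Index set of a fixed Hilbert basis of `E`. -/
def basisIndex : Set E := (exists_hilbertBasis ℂ E).choose

/-- A fixed Hilbert basis of `E`. -/
def basis : HilbertBasis (basisIndex E) ℂ E := (exists_hilbertBasis ℂ E).choose_spec.choose

variable {E}

/-- The trace `∑ᵢ ⟨eᵢ, A eᵢ⟩`. It is used only for trace-class operators (products of a density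
operator and bounded operators), where the series converges absolutely and its sum does not depend
on the Hilbert basis. -/
def trace (A : E →L[ℂ] E) : ℂ := ∑' i, inner ℂ (basis E i) (A (basis E i))

/-- Density operators: positive operators for which the series `∑ᵢ ⟨eᵢ, ρ eᵢ⟩` converges to `1`. For
a positive operator this does not depend on the Hilbert basis, and it implies trace class. -/
structure IsDensityOperator (ρ : E →L[ℂ] E) : Prop where
  isPositive : ρ.IsPositive
  hasSum_trace : HasSum (fun i => inner ℂ (basis E i) (ρ (basis E i))) 1

end Trace

/-! ### `M` bosonic modes in the Schrödinger representation -/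

/-- The Hilbert space `L²(ℝ^M; ℂ)` of `M` bosonic modes. -/
abbrev ModeSpace (M : ℕ) : Type := Lp ℂ 2 (volume : Measure (Fin M → ℝ))

/-- Annihilation operator `a_m = (x_m + ∂_m) / √2`, acting on functions. -/
def annihilation {M : ℕ} (m : Fin M) (f : (Fin M → ℝ) → ℂ) (x : Fin M → ℝ) : ℂ :=
  (x m * f x + fderiv ℝ f x (Pi.single m 1)) / (√2 : ℝ)

/-- Creation operator `a_m† = (x_m - ∂_m) / √2`, acting on functions. -/
def creation {M : ℕ} (m : Fin M) (f : (Fin M → ℝ) → ℂ) (x : Fin M → ℝ) : ℂ :=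
  (x m * f x - fderiv ℝ f x (Pi.single m 1)) / (√2 : ℝ)

/-- The phase factor in the displacement operator. -/
def displacePhase {M : ℕ} (ξ : Fin M → ℂ) (x : Fin M → ℝ) : ℂ :=
  Complex.exp (((∑ m, (√2 * (ξ m).im * x m - (ξ m).re * (ξ m).im) : ℝ) : ℂ) * Complex.I)

/-- The translation of configuration space in the displacement operator. -/
def displaceShift {M : ℕ} (ξ : Fin M → ℂ) : Fin M → ℝ := fun m => √2 * (ξ m).re

/-- The action of `D(ξ) = exp (∑ₘ ξₘ aₘ† - ξₘ* aₘ)` on functions on `ℝ^M`. The lemmas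
`displaceFun_add` and `hasDerivAt_displaceFun` say that `t ↦ D(tξ)` is a one-parameter group with
generator `∑ₘ ξₘ aₘ† - ξₘ* aₘ`. -/
def displaceFun {M : ℕ} (ξ : Fin M → ℂ) (f : (Fin M → ℝ) → ℂ) (x : Fin M → ℝ) : ℂ :=
  displacePhase ξ x * f (x - displaceShift ξ)

theorem displaceFun_add {M : ℕ} (ξ : Fin M → ℂ) (f : (Fin M → ℝ) → ℂ) (s t : ℝ) :
    displaceFun ((s + t) • ξ) f = displaceFun (s • ξ) (displaceFun (t • ξ) f) := by
  funext x
  have h1 : x - displaceShift ((s + t) • ξ)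
      = x - displaceShift (s • ξ) - displaceShift (t • ξ) := by
    funext m
    simp [displaceShift]
    ring
  have h2 : displacePhase ((s + t) • ξ) x
      = displacePhase (s • ξ) x * displacePhase (t • ξ) (x - displaceShift (s • ξ)) := by
    have h3 : (√2 : ℝ) * √2 = 2 := Real.mul_self_sqrt (by norm_num)
    rw [displacePhase, displacePhase, displacePhase, ← Complex.exp_add, ← add_mul,
      ← Complex.ofReal_add, ← Finset.sum_add_distrib]
    congr 3
    refine Finset.sum_congr rfl fun m _ => ?_
    simp only [displaceShift, Pi.smul_apply, Pi.sub_apply, Complex.real_smul, Complex.re_ofReal_mul,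
      Complex.im_ofReal_mul]
    linear_combination (t * (ξ m).im * s * (ξ m).re) * h3
  simp only [displaceFun, h1, h2, mul_assoc]

theorem hasDerivAt_displaceFun {M : ℕ} (ξ : Fin M → ℂ) (f : (Fin M → ℝ) → ℂ) (x : Fin M → ℝ)
    (hf : DifferentiableAt ℝ f x) :
    HasDerivAt (fun t : ℝ => displaceFun (t • ξ) f x)
      (∑ m, (ξ m * creation m f x - starRingEnd ℂ (ξ m) * annihilation m f x)) 0 := by
  have hs : ((√2 : ℝ) : ℂ) * ((√2 : ℝ) : ℂ) = 2 := by
    rw [← Complex.ofReal_mul, Real.mul_self_sqrt (by norm_num)]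
    norm_num
  have hs0 : ((√2 : ℝ) : ℂ) ≠ 0 := by
    simp
  have hphase : HasDerivAt (fun t : ℝ => displacePhase (t • ξ) x)
      (((∑ m, √2 * (ξ m).im * x m : ℝ) : ℂ) * Complex.I) 0 := by
    have h1 : HasDerivAt (fun t : ℝ => ∑ m, (√2 * ((t • ξ) m).im * x m
        - ((t • ξ) m).re * ((t • ξ) m).im)) (∑ m, √2 * (ξ m).im * x m) 0 := by
      refine HasDerivAt.fun_sum fun m _ => ?_
      have h2 := (((hasDerivAt_id (0 : ℝ)).mul_const (√2 * (ξ m).im * x m)).sub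
        (((hasDerivAt_id (0 : ℝ)).pow 2).mul_const ((ξ m).re * (ξ m).im)))
      convert h2 using 1
      · funext t
        simp
        ring
      · simp
    have h3 := (h1.ofReal_comp.mul_const Complex.I).cexp
    refine h3.congr_deriv ?_
    simp
  have hshift : HasDerivAt (fun t : ℝ => f (x - displaceShift (t • ξ)))
      (fderiv ℝ f x (-displaceShift ξ)) 0 := by
    have h1 : HasDerivAt (fun t : ℝ => x - displaceShift (t • ξ)) (-displaceShift ξ) 0 := by
      have h2 := ((hasDerivAt_id (0 : ℝ)).smul_const (displaceShift ξ)).const_sub x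
      have h3 : (fun t : ℝ => x - displaceShift (t • ξ))
          = fun t : ℝ => x - id t • displaceShift ξ := by
        funext t m
        simp [displaceShift]
        ring
      rw [h3]
      exact h2.congr_deriv (by rw [one_smul])
    have h0 : x - displaceShift ((0 : ℝ) • ξ) = x := by
      funext m
      simp [displaceShift]
    have hf' : HasFDerivAt f (fderiv ℝ f x) (x - displaceShift ((0 : ℝ) • ξ)) := by
      rw [h0]
      exact hf.hasFDerivAt
    exact hf'.comp_hasDerivAt (0 : ℝ) h1
  have h := hphase.mul hshift
  refine h.congr_deriv ?_
  symm
  have e1 : displacePhase ((0 : ℝ) • ξ) x = 1 := by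
    simp [displacePhase]
  have e2 : x - displaceShift ((0 : ℝ) • ξ) = x := by
    funext m
    simp [displaceShift]
  have e3 : fderiv ℝ f x (-displaceShift ξ)
      = -∑ m, ((√2 : ℝ) : ℂ) * ((ξ m).re : ℂ) * fderiv ℝ f x (Pi.single m 1) := by
    rw [map_neg]
    congr 1
    conv_lhs => rw [pi_eq_sum_univ' (displaceShift ξ)]
    rw [map_sum]
    refine Finset.sum_congr rfl fun m _ => ?_
    rw [map_smul, Complex.real_smul]
    congr 1
    simp [displaceShift]
  rw [e1, e2, e3]
  push_cast
  rw [Finset.sum_mul, Finset.sum_mul, one_mul, ← Finset.sum_neg_distrib, ← Finset.sum_add_distrib]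
  refine Finset.sum_congr rfl fun m _ => ?_
  have hz : ξ m = ((ξ m).re : ℂ) + ((ξ m).im : ℂ) * Complex.I := (Complex.re_add_im _).symm
  have hzc : starRingEnd ℂ (ξ m) = ((ξ m).re : ℂ) - ((ξ m).im : ℂ) * Complex.I := by
    apply Complex.ext <;> simp
  rw [creation, annihilation, hzc]
  nth_rewrite 1 [hz]
  field_simp
  linear_combination (((ξ m).re : ℂ) * fderiv ℝ f x (Pi.single m 1)
    - ((ξ m).im : ℂ) * Complex.I * x m * f x) * hs

theorem continuous_displacePhase {M : ℕ} (ξ : Fin M → ℂ) : Continuous (displacePhase ξ) := by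
  unfold displacePhase
  fun_prop

theorem norm_displacePhase {M : ℕ} (ξ : Fin M → ℂ) (x : Fin M → ℝ) : ‖displacePhase ξ x‖ = 1 :=
  Complex.norm_exp_ofReal_mul_I _

theorem eLpNorm_displaceFun {M : ℕ} (ξ : Fin M → ℂ) {f : (Fin M → ℝ) → ℂ}
    (hf : AEStronglyMeasurable f volume) :
    eLpNorm (displaceFun ξ f) 2 volume = eLpNorm f 2 volume := by
  rw [← eLpNorm_comp_measurePreserving hf (measurePreserving_sub_right volume (displaceShift ξ))]
  refine eLpNorm_congr_norm_ae (Filter.Eventually.of_forall fun x => ?_)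
  simp [displaceFun, norm_displacePhase]

theorem memLp_displaceFun {M : ℕ} (ξ : Fin M → ℂ) {f : (Fin M → ℝ) → ℂ}
    (hf : MemLp f 2 volume) : MemLp (displaceFun ξ f) 2 volume := by
  refine ⟨(continuous_displacePhase ξ).aestronglyMeasurable.mul
    (hf.1.comp_measurePreserving (measurePreserving_sub_right volume (displaceShift ξ))), ?_⟩
  rw [eLpNorm_displaceFun ξ hf.1]
  exact hf.2

theorem displaceFun_congr {M : ℕ} (ξ : Fin M → ℂ) {f g : (Fin M → ℝ) → ℂ}
    (h : f =ᵐ[volume] g) : displaceFun ξ f =ᵐ[volume] displaceFun ξ g := by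
  have h' := (measurePreserving_sub_right volume
    (displaceShift ξ)).quasiMeasurePreserving.ae_eq_comp h
  filter_upwards [h'] with x hx
  simpa [displaceFun, norm_displacePhase] using Or.inl hx

/-- The displacement operator `D(ξ)` on `L²(ℝ^M; ℂ)`. -/
def displacementIsometry {M : ℕ} (ξ : Fin M → ℂ) : ModeSpace M →ₗᵢ[ℂ] ModeSpace M where
  toFun f := (memLp_displaceFun ξ (Lp.memLp f)).toLp
  map_add' f g := by
    rw [← MemLp.toLp_add, MemLp.toLp_eq_toLp_iff]
    refine (displaceFun_congr ξ (Lp.coeFn_add f g)).trans (Filter.Eventually.of_forall fun x => ?_)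
    simp [displaceFun, mul_add]
  map_smul' c f := by
    rw [RingHom.id_apply, ← MemLp.toLp_const_smul, MemLp.toLp_eq_toLp_iff]
    refine (displaceFun_congr ξ (Lp.coeFn_smul c f)).trans (Filter.Eventually.of_forall fun x => ?_)
    simp [displaceFun, mul_left_comm]
  norm_map' f := by
    change ‖(memLp_displaceFun ξ (Lp.memLp f)).toLp‖ = _
    rw [Lp.norm_toLp, eLpNorm_displaceFun ξ (Lp.memLp f).1, Lp.norm_def]

/-- The displacement operator `D(ξ)` as a bounded operator. -/
def displacement {M : ℕ} (ξ : Fin M → ℂ) : ModeSpace M →L[ℂ] ModeSpace M :=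
  (displacementIsometry ξ).toContinuousLinearMap

/-- The parity operator `(Πψ)(x) = ψ(-x)`. -/
def parity (M : ℕ) : ModeSpace M →L[ℂ] ModeSpace M :=
  (Lp.compMeasurePreservingₗᵢ ℂ (fun x : Fin M → ℝ => -x)
    (Measure.measurePreserving_neg volume)).toContinuousLinearMap

/-! ### Wigner function, negativity volume and the witness -/

/-- The Wigner function `W_ρ(α) = (2/π)^M tr[ρ D(α) Π D(α)†]`. The trace is real for a density
operator, since `D(α) Π D(α)†` is self-adjoint. It is normalised with respect to
`∏ₘ d(Re αₘ) d(Im αₘ)`, which is the Lebesgue measure `volume` on `Fin M → ℂ`. -/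
def wigner {M : ℕ} (ρ : ModeSpace M →L[ℂ] ModeSpace M) (α : Fin M → ℂ) : ℝ :=
  (2 / Real.pi) ^ M *
    (trace (ρ ∘L displacement α ∘L parity M ∘L
      ContinuousLinearMap.adjoint (displacement α))).re

/-- The Wigner negativity volume `½ ∫ (|W_ρ| - W_ρ)`, with values in `[0, ∞]`. -/
def negativityVolume {M : ℕ} (ρ : ModeSpace M →L[ℂ] ModeSpace M) : ℝ≥0∞ :=
  (1 / 2) * ∫⁻ α : Fin M → ℂ, ENNReal.ofReal (|wigner ρ α| - wigner ρ α)

/-- The matrix `C(ρ, Ξ)` with entries `(1/N) tr[ρ D(ξⱼ - ξₖ)]`. -/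
def charMatrix {M N : ℕ} (ρ : ModeSpace M →L[ℂ] ModeSpace M) (Ξ : Fin N → Fin M → ℂ) :
    Matrix (Fin N) (Fin N) ℂ :=
  Matrix.of fun j k => (1 / (N : ℂ)) * trace (ρ ∘L displacement (Ξ j - Ξ k))

/-- The real eigenvalues of a complex square matrix. -/
def realEigenvalues {N : ℕ} (C : Matrix (Fin N) (Fin N) ℂ) : Set ℝ :=
  {μ : ℝ | Module.End.HasEigenvalue (Matrix.toLin' C) (μ : ℂ)}

/-- The smallest eigenvalue of a Hermitian matrix. -/
def smallestEigenvalue {N : ℕ} (C : Matrix (Fin N) (Fin N) ℂ) : ℝ := sInf (realEigenvalues C)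

/-- The witness `N_C(ρ, Ξ) = max(0, -λ₋)`. -/
def witness {M N : ℕ} (ρ : ModeSpace M →L[ℂ] ModeSpace M) (Ξ : Fin N → Fin M → ℂ) : ℝ :=
  max 0 (-smallestEigenvalue (charMatrix ρ Ξ))

end WignerNeg

end

/-!
A positive operator `ρ` with finite trace is a mixture of pure states `ψ`. For one of them,
`⟨ψ, D(ξ) Π D(ξ)† ψ⟩` and `⟨ψ, D(ξ) ψ⟩` are Fourier integrals of the same correlation
`ψ* (s + y) ψ (s - y)`, in `y` and in `s` respectively, so that `tr[ρ D(ξ)]` is the symplectic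
Fourier transform of `W_ρ`. As `W_ρ` need not be integrable, a Gaussian cutoff `g_r` is inserted:
`∫ g_r(α) exp (ξ·α* - ξ*·α) W_ρ(α) dα` is a Gaussian average of `tr[ρ D]` over a ball of radius
about `r` around `ξ`, and tends to `tr[ρ D(ξ)]` as `r → 0`. Hence `N ⟨u, C u⟩` is the limit of
`∫ g_r |h|² W_ρ`, where `h` is a trigonometric polynomial with coefficients of modulus `|u_j|`. As
`0 ≤ g_r |h|² ≤ N ‖u‖²`, such an integral is at least `- N ‖u‖² N_V(ρ)`, and an eigenvector `u` for
the eigenvalue `λ₋` gives `λ₋ ≥ - N_V(ρ)`.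
-/

noncomputable section

namespace WignerNeg

section TraceClass

variable {ι J E : Type*} [NormedAddCommGroup E] [InnerProductSpace ℂ E]

theorem hasSum_norm_inner_sq (b : HilbertBasis ι ℂ E) (v : E) :
    HasSum (fun i => ‖inner ℂ (b i) v‖ ^ 2) (‖v‖ ^ 2) := by
  have h := Complex.hasSum_re (b.hasSum_inner_mul_inner v v)
  rw [inner_self_eq_norm_sq_to_K, RCLike.ofReal_eq_complex_ofReal, ← Complex.ofReal_pow,
    Complex.ofReal_re] at h
  refine h.congr_fun fun i => ?_
  rw [← inner_conj_symm v, Complex.conj_mul', ← Complex.ofReal_pow, Complex.ofReal_re]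

theorem summable_norm_inner_sq_prod (b : HilbertBasis ι ℂ E) {v : J → E}
    (hv : Summable fun j => ‖v j‖ ^ 2) :
    Summable fun p : J × ι => ‖inner ℂ (b p.2) (v p.1)‖ ^ 2 := by
  rw [summable_prod_of_nonneg fun p => by positivity]
  refine ⟨fun j => (hasSum_norm_inner_sq b (v j)).summable, ?_⟩
  simpa only [(hasSum_norm_inner_sq b (v _)).tsum_eq] using hv

variable [CompleteSpace E]

open ContinuousLinearMap in
/-- Both sides are iterated sums of `⟨bᵢ, X bⱼ⟩ ⟨bⱼ, Y bᵢ⟩`. -/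
theorem hasSum_inner_comp_comm (b : HilbertBasis ι ℂ E) {X Y : E →L[ℂ] E}
    (hX : Summable fun i => ‖X (b i)‖ ^ 2) (hY : Summable fun i => ‖Y (b i)‖ ^ 2) :
    HasSum (fun i => inner ℂ (b i) (X (Y (b i)))) (∑' i, inner ℂ (b i) (Y (X (b i)))) := by
  let F : ι × ι → ℂ := fun p => inner ℂ (b p.1) (X (b p.2)) * inner ℂ (b p.2) (Y (b p.1))
  have hF : Summable F := by
    have hXY := ((Equiv.prodComm ι ι).summable_iff.2 (summable_norm_inner_sq_prod b hX)).add
      (summable_norm_inner_sq_prod b hY)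
    refine Summable.of_norm_bounded hXY fun p => ?_
    rw [norm_mul]
    set x := ‖inner ℂ (b p.1) (X (b p.2))‖
    set y := ‖inner ℂ (b p.2) (Y (b p.1))‖
    change x * y ≤ x ^ 2 + y ^ 2
    nlinarith [sq_nonneg (x - y), sq_nonneg x, sq_nonneg y]
  have hrow : HasSum (fun i => inner ℂ (b i) (X (Y (b i)))) (∑' p, F p) := by
    refine hF.hasSum.prod_fiberwise fun i => ?_
    simpa only [adjoint_inner_left] using b.hasSum_inner_mul_inner (adjoint X (b i)) (Y (b i))
  have hcol : HasSum (fun j => inner ℂ (b j) (Y (X (b j)))) (∑' p, F p) := by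
    refine HasSum.prod_fiberwise ((Equiv.prodComm ι ι).hasSum_iff.2 hF.hasSum) fun j => ?_
    simpa only [adjoint_inner_left, F, Function.comp_apply, Equiv.prodComm_apply,
      Prod.swap_prod_mk, mul_comm] using b.hasSum_inner_mul_inner (adjoint Y (b j)) (X (b j))
  rwa [hcol.tsum_eq]

/-- A decomposition of a positive trace-class operator `ρ` into the (unnormalised) pure states
`ψ i`, expressed through the expectation values `tr (ρ A) = ∑ᵢ ⟨ψᵢ, A ψᵢ⟩`. -/
structure IsEnsemble (ρ : E →L[ℂ] E) (ψ : J → E) : Prop where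
  summable_norm_sq : Summable fun i => ‖ψ i‖ ^ 2
  hasSum_inner : ∀ A : E →L[ℂ] E, HasSum (fun i => inner ℂ (ψ i) (A (ψ i))) (trace (ρ ∘L A))

variable {ρ : E →L[ℂ] E}

open ContinuousLinearMap in
theorem trace_comp_eq_star_trace_adjoint_comp (hρ : IsSelfAdjoint ρ) (A : E →L[ℂ] E) :
    trace (ρ ∘L A) = star (trace (adjoint A ∘L ρ)) := by
  rw [trace, trace, tsum_star]
  refine tsum_congr fun i => ?_
  rw [comp_apply, comp_apply, adjoint_inner_right, Complex.star_def, inner_conj_symm,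
    ← adjoint_inner_left, hρ.adjoint_eq]

open ContinuousLinearMap in
theorem isEnsemble_sqrt (hρ : ρ.IsPositive)
    (htr : Summable fun i => inner ℂ (basis E i) (ρ (basis E i))) :
    IsEnsemble ρ fun i => CFC.sqrt ρ (basis E i) := by
  have hρ₀ : 0 ≤ ρ := (nonneg_iff_isPositive ρ).2 hρ
  set S := CFC.sqrt ρ
  have hSS : ∀ x, S (S x) = ρ x := fun x => congr($(CFC.sqrt_mul_sqrt_self ρ hρ₀) x)
  have hS : ∀ x y, inner ℂ (S x) y = inner ℂ x (S y) :=
    (CFC.sqrt_nonneg ρ).isSelfAdjoint.isSymmetric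
  have hsum : Summable fun i => ‖S (basis E i)‖ ^ 2 := by
    simpa [← hSS, ← hS, inner_self_eq_norm_sq_to_K, ← Complex.ofReal_pow] using
      Complex.reCLM.summable htr
  refine ⟨hsum, fun A => ?_⟩
  have hAS : Summable fun i => ‖(adjoint A ∘L S) (basis E i)‖ ^ 2 := by
    refine Summable.of_nonneg_of_le (fun i => by positivity) (fun i => ?_)
      (hsum.mul_left (‖adjoint A‖ ^ 2))
    rw [← mul_pow]
    gcongr
    exact (adjoint A).le_opNorm _
  have h := (hasSum_inner_comp_comm (basis E) hsum hAS).star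
  rw [trace_comp_eq_star_trace_adjoint_comp hρ.isSelfAdjoint]
  simpa [trace, hSS, ← hS, adjoint_inner_right] using h

theorem exists_isEnsemble (hρ : ρ.IsPositive)
    (htr : Summable fun i => inner ℂ (basis E i) (ρ (basis E i))) :
    ∃ (J : Set (basisIndex E)) (ψ : J → E), Countable J ∧ IsEnsemble ρ ψ := by
  have h := isEnsemble_sqrt hρ htr
  set ψ := fun i => CFC.sqrt ρ (basis E i)
  have hsupp : ∀ A : E →L[ℂ] E, (Function.support fun i => inner ℂ (ψ i) (A (ψ i)))
      ⊆ Function.support fun i => ‖ψ i‖ ^ 2 := fun A => by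
    refine Function.support_subset_iff'.2 fun i hi => ?_
    have hi₀ : ψ i = 0 := by simpa using hi
    simp only [hi₀, inner_zero_left]
  exact ⟨Function.support fun i => ‖ψ i‖ ^ 2, fun i => ψ i, h.summable_norm_sq.countable_support,
    h.summable_norm_sq.subtype _,
    fun A => (hasSum_subtype_iff_of_support_subset (hsupp A)).2 (h.hasSum_inner A)⟩

theorem IsEnsemble.star_trace {ψ : J → E} (hψ : IsEnsemble ρ ψ) (A : E →L[ℂ] E) :
    star (trace (ρ ∘L A)) = trace (ρ ∘L ContinuousLinearMap.adjoint A) := by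
  refine (hψ.hasSum_inner A).star.unique ?_
  simpa only [ContinuousLinearMap.adjoint_inner_right, Complex.star_def, inner_conj_symm]
    using hψ.hasSum_inner (ContinuousLinearMap.adjoint A)

end TraceClass

section Gaussian

variable {ι X : Type*} [Fintype ι] [TopologicalSpace X]

/-- The character `exp (i t·y)` of `ℝ^ι`. -/
def phase (t y : ι → ℝ) : ℂ := Complex.exp ((t ⬝ᵥ y : ℝ) * Complex.I)

theorem norm_phase (t y : ι → ℝ) : ‖phase t y‖ = 1 := Complex.norm_exp_ofReal_mul_I _

theorem phase_add (s t y : ι → ℝ) : phase (s + t) y = phase s y * phase t y := by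
  rw [phase, phase, phase, ← Complex.exp_add, ← add_mul, ← Complex.ofReal_add, add_dotProduct]

theorem phase_zero (y : ι → ℝ) : phase 0 y = 1 := by
  rw [phase, zero_dotProduct, Complex.ofReal_zero, zero_mul, Complex.exp_zero]

theorem phase_comm (t y : ι → ℝ) : phase t y = phase y t := by
  rw [phase, phase, dotProduct_comm]

theorem phase_smul (c : ℝ) (t y : ι → ℝ) : phase (c • t) y = phase t (c • y) := by
  rw [phase, phase, smul_dotProduct, dotProduct_smul]

@[fun_prop]
theorem continuous_phase {f g : X → ι → ℝ} (hf : Continuous f) (hg : Continuous g) :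
    Continuous fun x => phase (f x) (g x) := by
  unfold phase dotProduct
  fun_prop

/-- The Gaussian `exp (-r² |s|²)` on `ℝ^ι`, used as a cutoff of width `1 / r`. -/
def gauss (r : ℝ) (s : ι → ℝ) : ℝ := Real.exp (-(r ^ 2 * (s ⬝ᵥ s)))

theorem gauss_pos (r : ℝ) (s : ι → ℝ) : 0 < gauss r s := Real.exp_pos _

theorem gauss_le_one (r : ℝ) (s : ι → ℝ) : gauss r s ≤ 1 :=
  Real.exp_le_one_iff.2 (neg_nonpos.2 (mul_nonneg (sq_nonneg r)
    (Finset.sum_nonneg fun m _ => mul_self_nonneg (s m))))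

theorem norm_gauss (r : ℝ) (s : ι → ℝ) : ‖(gauss r s : ℂ)‖ = gauss r s := by
  rw [Complex.norm_real, Real.norm_of_nonneg (gauss_pos r s).le]

theorem gauss_zero (r : ℝ) : gauss r (0 : ι → ℝ) = 1 := by
  rw [gauss, zero_dotProduct, mul_zero, neg_zero, Real.exp_zero]

theorem gauss_smul (r c : ℝ) (s : ι → ℝ) : gauss r (c • s) = gauss (r * c) s := by
  simp only [gauss, smul_dotProduct, dotProduct_smul, smul_eq_mul, mul_pow]
  congr 2
  ring

@[fun_prop]
theorem continuous_gauss (r : ℝ) {f : X → ι → ℝ} (hf : Continuous f) :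
    Continuous fun x => gauss r (f x) := by
  unfold gauss dotProduct
  fun_prop

theorem gauss_mul_phase_eq_cexp (r : ℝ) (v t : ι → ℝ) :
    (gauss r t : ℂ) * phase v t
      = Complex.exp (-(r : ℂ) ^ 2 * ∑ m, (t m : ℂ) ^ 2
        + ∑ m, (v m * Complex.I) * (t m : ℂ)) := by
  rw [gauss, phase, Complex.ofReal_exp, ← Complex.exp_add]
  simp only [dotProduct, Complex.ofReal_neg, Complex.ofReal_mul, Complex.ofReal_sum, Finset.sum_mul,
    Complex.ofReal_pow, neg_mul, ← sq, mul_right_comm _ Complex.I]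

theorem re_ofReal_sq_pos {r : ℝ} (hr : 0 < r) : 0 < ((r : ℂ) ^ 2).re := by
  rw [← Complex.ofReal_pow, Complex.ofReal_re]
  positivity

theorem integrable_gauss {r : ℝ} (hr : 0 < r) : Integrable fun t : ι → ℝ => gauss r t := by
  refine (GaussianFourier.integrable_cexp_neg_mul_sum_add (re_ofReal_sq_pos hr)
    fun m => ((0 : ι → ℝ) m * Complex.I)).norm.congr (ae_of_all _ fun t => ?_)
  simp only [← gauss_mul_phase_eq_cexp, norm_mul, norm_phase, norm_gauss, mul_one]

theorem integral_gauss_mul_phase {r : ℝ} (hr : 0 < r) (v : ι → ℝ) :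
    ∫ t, (gauss r t : ℂ) * phase v t
      = ((√Real.pi / r) ^ Fintype.card ι : ℝ) * gauss (1 / (2 * r)) v := by
  simp only [gauss_mul_phase_eq_cexp]
  rw [GaussianFourier.integral_cexp_neg_mul_sum_add (re_ofReal_sq_pos hr)]
  have hdim : (Fintype.card ι : ℂ) / 2 = ((1 / 2 * Fintype.card ι : ℝ) : ℂ) := by
    push_cast
    ring
  congr 1
  · rw [← Complex.ofReal_pow, ← Complex.ofReal_div, hdim, ← Complex.ofReal_cpow (by positivity),
      Real.rpow_mul (by positivity), Real.rpow_natCast, ← Real.sqrt_eq_rpow,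
      Real.sqrt_div Real.pi_pos.le, Real.sqrt_sq hr.le]
  · have hr₀ : (r : ℂ) ≠ 0 := by exact_mod_cast hr.ne'
    rw [gauss, Complex.ofReal_exp]
    congr 1
    simp only [mul_pow, Complex.I_sq, dotProduct]
    push_cast
    rw [← Finset.sum_mul]
    field_simp
    norm_num

theorem integral_gauss_one : ∫ t : ι → ℝ, gauss 1 t = √Real.pi ^ Fintype.card ι := by
  have h := integral_gauss_mul_phase one_pos (0 : ι → ℝ)
  simp only [phase_zero, gauss_zero, mul_one, div_one, Complex.ofReal_one,
    integral_complex_ofReal] at h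
  exact_mod_cast h

end Gaussian

section Fourier

variable {ι : Type*} [Fintype ι] {f : (ι → ℝ) → ℂ}

/-- The Fourier integral on `ℝ^ι` in the normalisation `∫ exp (i t·y) f(y) dy` of the
characteristic function of a random variable. -/
def fourierIntegral (f : (ι → ℝ) → ℂ) (t : ι → ℝ) : ℂ := ∫ y, phase t y * f y

theorem norm_fourierIntegral_le (f : (ι → ℝ) → ℂ) (t : ι → ℝ) :
    ‖fourierIntegral f t‖ ≤ ∫ y, ‖f y‖ :=
  (norm_integral_le_integral_norm _).trans_eq (by simp only [norm_mul, norm_phase, one_mul])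

theorem integrable_phase_mul (hf : Integrable f) (t : ι → ℝ) :
    Integrable fun y => phase t y * f y :=
  hf.bdd_mul (c := 1) (by fun_prop : Continuous fun y => phase t y).aestronglyMeasurable
    (ae_of_all _ fun y => (norm_phase t y).le)

theorem integral_gauss_mul_fourierIntegral {r : ℝ} (hr : 0 < r) (a : ℝ) (c : ι → ℝ)
    (hf : Integrable f) :
    ∫ t, (gauss r t : ℂ) * fourierIntegral f (c + a • t)
      = ((√Real.pi / r) ^ Fintype.card ι : ℝ) *
        ∫ y, gauss (1 / (2 * r) * a) y * (phase c y * f y) := by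
  have hint : Integrable (fun p : (ι → ℝ) × (ι → ℝ) =>
      phase (a • p.1) p.2 * ((gauss r p.1 : ℂ) * (phase c p.2 * f p.2)))
      (volume.prod volume) :=
    (((integrable_gauss hr).ofReal (𝕜 := ℂ)).mul_prod (integrable_phase_mul hf c)).bdd_mul (c := 1)
      (by fun_prop : Continuous fun p : (ι → ℝ) × (ι → ℝ) =>
        phase (a • p.1) p.2).aestronglyMeasurable (ae_of_all _ fun p => (norm_phase _ _).le)
  calc ∫ t, (gauss r t : ℂ) * fourierIntegral f (c + a • t)
      = ∫ t, ∫ y, phase (a • t) y * (gauss r t * (phase c y * f y)) := by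
        simp only [fourierIntegral, ← integral_const_mul, phase_add]
        congr! 4
        ring
    _ = ∫ y, ∫ t, gauss r t * phase (a • y) t * (phase c y * f y) := by
        rw [integral_integral_swap hint]
        congr! 4 with y t
        rw [phase_smul, phase_comm t]
        ring
    _ = _ := by
        simp only [integral_mul_const, integral_gauss_mul_phase hr, gauss_smul]
        simp only [mul_assoc, integral_const_mul]

theorem integral_gauss_mul_phase_mul {f : (ι → ℝ) → ℂ} (hf : Integrable f) (r : ℝ) (c : ι → ℝ) :
    ((√Real.pi ^ Fintype.card ι : ℝ) : ℂ) * ∫ y, gauss r y * (phase c y * f y)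
      = ∫ t, (gauss 1 t : ℂ) * fourierIntegral f (c + (2 * r) • t) := by
  rw [integral_gauss_mul_fourierIntegral one_pos _ _ hf, div_one,
    show 1 / (2 * 1) * (2 * r) = r by ring]

theorem fourierIntegral_comp_add_left (f : (ι → ℝ) → ℂ) (c t : ι → ℝ) :
    fourierIntegral (fun y => f (c + y)) t = phase t (-c) * fourierIntegral f t := by
  rw [fourierIntegral, fourierIntegral, ← integral_const_mul,
    ← integral_add_left_eq_self (fun y => phase t (-c) * (phase t y * f y)) c]
  refine integral_congr_ae (ae_of_all _ fun y => ?_)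
  simp only
  rw [← mul_assoc, phase_comm t (-c), phase_comm t (c + y), phase_comm t y, ← phase_add,
    neg_add_cancel_left]

/-- Fourier inversion at the point `c`, regularised by a Gaussian cutoff in frequency. -/
theorem integral_gauss_mul_phase_mul_fourierIntegral (hf : Integrable f) {r : ℝ} (hr : 0 < r)
    (c : ι → ℝ) :
    ∫ t, gauss r t * (phase ((2 : ℝ) • -c) t * fourierIntegral f ((2 : ℝ) • t))
      = ((√Real.pi ^ Fintype.card ι : ℝ) : ℂ) * ∫ z, gauss 1 z * f (c + r • z) := by
  have h := integral_gauss_mul_fourierIntegral hr 2 0 (hf.comp_add_left c)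
  simp only [zero_add, fourierIntegral_comp_add_left] at h
  have hphase : ∀ t, phase ((2 : ℝ) • -c) t = phase ((2 : ℝ) • t) (-c) := fun t => by
    rw [phase_smul, phase_comm]
  have hscale := Measure.integral_comp_smul_of_nonneg (volume : Measure (ι → ℝ))
    (fun y => (gauss (1 / (2 * r) * 2) y : ℂ) * f (c + y)) r (hR := hr.le)
  have hwidth : 1 / (2 * r) * 2 * r = 1 := by field_simp
  simp only [gauss_smul, hwidth, Module.finrank_fintype_fun_eq_card, Complex.real_smul] at hscale
  simp only [hphase]
  rw [h, hscale, ← mul_assoc, ← Complex.ofReal_mul, ← div_eq_mul_inv, ← div_pow]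
  simp only [phase_zero, one_mul]

end Fourier

section ConjMul

variable {X : Type*} [MeasurableSpace X] {μ : Measure X}

/-- The product `conj u · v` as a continuous sesquilinear map `L² × L² → L¹`. It is bundled as a
real bilinear map, since Hölder's inequality is available for bilinear maps only. -/
def conjMul (μ : Measure X) : Lp ℂ 2 μ →L[ℝ] Lp ℂ 2 μ →L[ℝ] Lp ℂ 1 μ :=
  ((ContinuousLinearMap.mul ℝ ℂ).comp (Complex.conjCLE : ℂ →L[ℝ] ℂ)).holderL μ 2 2 1

theorem coeFn_conjMul (u v : Lp ℂ 2 μ) :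
    conjMul μ u v =ᵐ[μ] fun x => starRingEnd ℂ (u x) * v x :=
  ContinuousLinearMap.coeFn_holder _ u v

theorem norm_conjMul_le (u v : Lp ℂ 2 μ) : ‖conjMul μ u v‖ ≤ ‖u‖ * ‖v‖ := by
  refine (ContinuousLinearMap.norm_holder_apply_apply_le _ u v).trans ?_
  gcongr
  refine mul_le_of_le_one_left (norm_nonneg _)
    (ContinuousLinearMap.opNorm_le_bound _ zero_le_one fun z => ?_)
  simp

theorem integrable_conj_mul {f : X → ℂ} {u v : Lp ℂ 2 μ}
    (hf : f =ᵐ[μ] fun x => starRingEnd ℂ (u x) * v x) : Integrable f μ :=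
  (L1.integrable_coeFn (conjMul μ u v)).congr ((coeFn_conjMul u v).trans hf.symm)

theorem integral_norm_conj_mul_le {f : X → ℂ} {u v : Lp ℂ 2 μ}
    (hf : f =ᵐ[μ] fun x => starRingEnd ℂ (u x) * v x) : ∫ x, ‖f x‖ ∂μ ≤ ‖u‖ * ‖v‖ := by
  refine Eq.trans_le ?_ (norm_conjMul_le u v)
  rw [L1.norm_eq_integral_norm]
  exact integral_congr_ae ((hf.trans (coeFn_conjMul u v).symm).fun_comp norm)

end ConjMul

section Correlation

variable {ι : Type*} [Fintype ι]

/-- The translate `x ↦ ψ (x + h)` in `L²`. -/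
def translate (h : ι → ℝ) (ψ : Lp ℂ 2 (volume : Measure (ι → ℝ))) :
    Lp ℂ 2 (volume : Measure (ι → ℝ)) :=
  Lp.compMeasurePreserving (· + h) (measurePreserving_add_right volume h) ψ

theorem continuous_translate (ψ : Lp ℂ 2 (volume : Measure (ι → ℝ))) :
    Continuous fun h => translate h ψ :=
  let T : C(ι → ℝ, C(ι → ℝ, ι → ℝ)) := ContinuousMap.curry ⟨fun p => p.2 + p.1, by fun_prop⟩
  continuous_const.compMeasurePreservingLp T.continuous
    (fun h => measurePreserving_add_right volume h) (by simp)

/-- The correlation `conj f(s + y) f(s - y)` of a wave function about the point `s`. -/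
def correlation (f : (ι → ℝ) → ℂ) (s y : ι → ℝ) : ℂ := starRingEnd ℂ (f (s + y)) * f (s - y)

variable (ψ : Lp ℂ 2 (volume : Measure (ι → ℝ)))

theorem stronglyMeasurable_correlation :
    StronglyMeasurable fun p : (ι → ℝ) × (ι → ℝ) => correlation ψ p.1 p.2 :=
  (Complex.continuous_conj.comp_stronglyMeasurable
    ((Lp.stronglyMeasurable ψ).comp_measurable (measurable_fst.add measurable_snd))).mul
    ((Lp.stronglyMeasurable ψ).comp_measurable (measurable_fst.sub measurable_snd))

theorem correlation_ae_eq_left (y : ι → ℝ) : (fun s => correlation ψ s y)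
    =ᵐ[volume] fun s => starRingEnd ℂ (translate y ψ s) * translate (-y) ψ s := by
  filter_upwards [Lp.coeFn_compMeasurePreserving ψ (measurePreserving_add_right volume y),
    Lp.coeFn_compMeasurePreserving ψ (measurePreserving_add_right volume (-y))] with s h₁ h₂
  rw [translate, translate, h₁, h₂, correlation, sub_eq_add_neg]
  rfl

theorem correlation_ae_eq_right (s : ι → ℝ) : correlation ψ s =ᵐ[volume] fun y =>
    starRingEnd ℂ (translate s ψ y) *
      Lp.compMeasurePreserving (s - ·) (Measure.measurePreserving_sub_left volume s) ψ y := by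
  filter_upwards [Lp.coeFn_compMeasurePreserving ψ (measurePreserving_add_right volume s),
    Lp.coeFn_compMeasurePreserving ψ (Measure.measurePreserving_sub_left volume s)] with y h₁ h₂
  rw [translate, h₁, h₂, correlation, add_comm]
  rfl

/-- The correlation at separation `y` as an element of `L¹`. -/
def correlationL1 (y : ι → ℝ) : Lp ℂ 1 (volume : Measure (ι → ℝ)) :=
  conjMul volume (translate y ψ) (translate (-y) ψ)

theorem coeFn_correlationL1 (y : ι → ℝ) :
    correlationL1 ψ y =ᵐ[volume] fun s => correlation ψ s y :=
  (coeFn_conjMul _ _).trans (correlation_ae_eq_left ψ y).symm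

theorem continuous_correlationL1 : Continuous (correlationL1 ψ) :=
  ((conjMul volume).continuous.comp (continuous_translate ψ)).clm_apply
    ((continuous_translate ψ).comp continuous_neg)

theorem integrable_correlation_left (y : ι → ℝ) : Integrable fun s => correlation ψ s y :=
  integrable_conj_mul (correlation_ae_eq_left ψ y)

theorem integrable_correlation_right (s : ι → ℝ) : Integrable (correlation ψ s) :=
  integrable_conj_mul (correlation_ae_eq_right ψ s)

theorem integral_norm_correlation_left_le (y : ι → ℝ) :
    ∫ s, ‖correlation ψ s y‖ ≤ ‖ψ‖ ^ 2 := by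
  refine (integral_norm_conj_mul_le (correlation_ae_eq_left ψ y)).trans_eq ?_
  rw [translate, translate, Lp.norm_compMeasurePreserving, Lp.norm_compMeasurePreserving, sq]

theorem integral_norm_correlation_right_le (s : ι → ℝ) :
    ∫ y, ‖correlation ψ s y‖ ≤ ‖ψ‖ ^ 2 := by
  refine (integral_norm_conj_mul_le (correlation_ae_eq_right ψ s)).trans_eq ?_
  rw [translate, Lp.norm_compMeasurePreserving, Lp.norm_compMeasurePreserving, sq]

end Correlation

section Ambiguity

variable {ι : Type*} [Fintype ι]

theorem continuous_fourierIntegral_L1 :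
    Continuous fun x : (ι → ℝ) × Lp ℂ 1 (volume : Measure (ι → ℝ)) =>
      fourierIntegral x.2 x.1 := by
  refine continuous_prod_of_continuous_lipschitzWith' _ 1
    (fun t => LipschitzWith.of_dist_le_mul fun f g => ?_) fun f => ?_
  · have hf := integrable_phase_mul (L1.integrable_coeFn f) t
    have hg := integrable_phase_mul (L1.integrable_coeFn g) t
    have hsub : fourierIntegral f t - fourierIntegral g t =
        fourierIntegral (f - g : Lp ℂ 1 _) t := by
      rw [fourierIntegral, fourierIntegral, ← integral_sub hf hg]
      refine integral_congr_ae ((Lp.coeFn_sub f g).mono fun y hy => ?_)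
      simp only [hy, Pi.sub_apply, mul_sub]
    rw [NNReal.coe_one, one_mul, dist_eq_norm, dist_eq_norm, hsub, L1.norm_eq_integral_norm]
    exact norm_fourierIntegral_le _ t
  · refine continuous_of_dominated
      (fun t => (integrable_phase_mul (L1.integrable_coeFn f) t).aestronglyMeasurable)
      (fun t => ae_of_all _ fun y => ?_) (L1.integrable_coeFn f).norm
      (ae_of_all _ fun y => ?_)
    · rw [norm_mul, norm_phase, one_mul]
    · exact (by fun_prop : Continuous fun t => phase t y * f y)

/-- The ambiguity function `∫ exp (i p·s) conj ψ(s + q / 2) ψ(s - q / 2) ds` of a wave function: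
the expectation value of the phase-space displacement by momentum `p` and position `q`. -/
def ambiguity (f : (ι → ℝ) → ℂ) (p q : ι → ℝ) : ℂ :=
  fourierIntegral (fun s => correlation f s ((1 / 2 : ℝ) • q)) p

/-- The Wigner integral `∫ exp (2 i p·y) conj ψ(s + y) ψ(s - y) dy` of a wave function. -/
def wignerIntegral (f : (ι → ℝ) → ℂ) (s p : ι → ℝ) : ℂ :=
  fourierIntegral (correlation f s) ((2 : ℝ) • p)

variable (ψ : Lp ℂ 2 (volume : Measure (ι → ℝ)))

theorem norm_ambiguity_le (p q : ι → ℝ) : ‖ambiguity ψ p q‖ ≤ ‖ψ‖ ^ 2 :=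
  (norm_fourierIntegral_le _ p).trans (integral_norm_correlation_left_le ψ _)

theorem norm_wignerIntegral_le (s p : ι → ℝ) : ‖wignerIntegral ψ s p‖ ≤ ‖ψ‖ ^ 2 :=
  (norm_fourierIntegral_le _ _).trans (integral_norm_correlation_right_le ψ s)

theorem ambiguity_eq_fourierIntegral_correlationL1 (p q : ι → ℝ) :
    ambiguity ψ p q = fourierIntegral (correlationL1 ψ ((1 / 2 : ℝ) • q)) p := by
  rw [ambiguity, fourierIntegral, fourierIntegral]
  refine integral_congr_ae ?_
  filter_upwards [coeFn_correlationL1 ψ ((1 / 2 : ℝ) • q)] with s hs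
  rw [hs]

theorem continuous_ambiguity :
    Continuous fun x : (ι → ℝ) × (ι → ℝ) => ambiguity ψ x.1 x.2 := by
  have hpair : Continuous fun x : (ι → ℝ) × (ι → ℝ) =>
      (x.1, correlationL1 ψ ((1 / 2 : ℝ) • x.2)) :=
    continuous_fst.prodMk ((continuous_correlationL1 ψ).comp (by fun_prop))
  refine (continuous_fourierIntegral_L1.comp hpair).congr fun x => ?_
  rw [ambiguity_eq_fourierIntegral_correlationL1, Function.comp_apply]

theorem stronglyMeasurable_wignerIntegral :
    StronglyMeasurable fun x : (ι → ℝ) × (ι → ℝ) => wignerIntegral ψ x.1 x.2 := by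
  have hphase : Continuous fun z : ((ι → ℝ) × (ι → ℝ)) × (ι → ℝ) =>
      phase ((2 : ℝ) • z.1.2) z.2 := by fun_prop
  refine (hphase.stronglyMeasurable.mul ((stronglyMeasurable_correlation ψ).comp_measurable
    (?_ : Measurable fun z : ((ι → ℝ) × (ι → ℝ)) × (ι → ℝ) => (z.1.1, z.2)))).integral_prod_right
  fun_prop

end Ambiguity

section GaussianCutoff

variable {ι : Type*} [Fintype ι] (ψ : Lp ℂ 2 (volume : Measure (ι → ℝ)))

theorem integrable_gauss_mul_gauss {r : ℝ} (hr : 0 < r) :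
    Integrable fun x : (ι → ℝ) × (ι → ℝ) => ((gauss r x.1 * gauss r x.2 : ℝ) : ℂ) :=
  ((integrable_gauss hr).mul_prod (integrable_gauss hr)).ofReal

theorem integrable_gauss_mul_gauss_mul_phase_mul_correlation (r : ℝ) (p c : ι → ℝ) :
    Integrable fun x : (ι → ℝ) × (ι → ℝ) => gauss 1 x.2 * (gauss r x.1 *
      (phase p x.1 * correlation ψ x.1 (c + r • x.2))) := by
  set F : (ι → ℝ) × (ι → ℝ) → ℂ := fun x => gauss 1 x.2 * (gauss r x.1 *
    (phase p x.1 * correlation ψ x.1 (c + r • x.2)))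
  have hF : AEStronglyMeasurable F (volume.prod volume) := by
    have hcorr := (stronglyMeasurable_correlation ψ).comp_measurable
      (by fun_prop : Measurable fun x : (ι → ℝ) × (ι → ℝ) => (x.1, c + r • x.2))
    have hg₁ : Continuous fun x : (ι → ℝ) × (ι → ℝ) => (gauss 1 x.2 : ℂ) := by fun_prop
    have hgr : Continuous fun x : (ι → ℝ) × (ι → ℝ) => (gauss r x.1 : ℂ) := by fun_prop
    have hp : Continuous fun x : (ι → ℝ) × (ι → ℝ) => phase p x.1 := by fun_prop
    exact (hg₁.stronglyMeasurable.mul (hgr.stronglyMeasurable.mul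
      (hp.stronglyMeasurable.mul hcorr))).aestronglyMeasurable
  have hslice : ∀ z, Integrable fun s => F (s, z) := fun z =>
    ((integrable_phase_mul (integrable_correlation_left ψ (c + r • z)) p).bdd_mul (c := 1)
      (by fun_prop : Continuous fun s => (gauss r s : ℂ)).aestronglyMeasurable
      (ae_of_all _ fun s => (norm_gauss r s).trans_le (gauss_le_one r s))).const_mul (gauss 1 z : ℂ)
  have hbound : ∀ z, ∫ s, ‖F (s, z)‖ ≤ gauss 1 z * ‖ψ‖ ^ 2 := fun z => by
    refine (integral_mono (hslice z).norm
      ((integrable_correlation_left ψ (c + r • z)).norm.const_mul (gauss 1 z)) fun s => ?_).trans ?_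
    · simp only [F, norm_mul, norm_gauss, norm_phase, one_mul]
      exact mul_le_mul_of_nonneg_left
        (mul_le_of_le_one_left (norm_nonneg _) (gauss_le_one r s)) (gauss_pos 1 z).le
    · rw [integral_const_mul]
      exact mul_le_mul_of_nonneg_left (integral_norm_correlation_left_le ψ _) (gauss_pos 1 z).le
  refine (integrable_prod_iff' hF).2 ⟨ae_of_all _ hslice, ?_⟩
  refine ((integrable_gauss one_pos).mul_const (‖ψ‖ ^ 2)).mono'
    hF.norm.prod_swap.integral_prod_right' (ae_of_all _ fun z => ?_)
  exact (Real.norm_of_nonneg (integral_nonneg fun s => norm_nonneg _)).trans_le (hbound z)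

theorem integrable_gauss_mul_wignerIntegral {r : ℝ} (hr : 0 < r) (p q : ι → ℝ) :
    Integrable fun x : (ι → ℝ) × (ι → ℝ) => ((gauss r x.1 * gauss r x.2 : ℝ) : ℂ) *
      (phase p x.1 * phase (-q) x.2 * wignerIntegral ψ x.1 x.2) := by
  have hphase : Continuous fun x : (ι → ℝ) × (ι → ℝ) => phase p x.1 * phase (-q) x.2 := by
    fun_prop
  refine (integrable_gauss_mul_gauss hr).mul_bdd (c := ‖ψ‖ ^ 2)
    (hphase.stronglyMeasurable.mul (stronglyMeasurable_wignerIntegral ψ)).aestronglyMeasurable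
    (ae_of_all _ fun x => ?_)
  rw [norm_mul, norm_mul, norm_phase, norm_phase, one_mul, one_mul]
  exact norm_wignerIntegral_le ψ _ _

theorem integrable_gauss_mul_ambiguity (r : ℝ) (p q : ι → ℝ) :
    Integrable fun x : (ι → ℝ) × (ι → ℝ) => ((gauss 1 x.1 * gauss 1 x.2 : ℝ) : ℂ) *
      ambiguity ψ (p + (2 * r) • x.2) (q + (2 * r) • x.1) := by
  refine (integrable_gauss_mul_gauss one_pos).mul_bdd (c := ‖ψ‖ ^ 2) ?_
    (ae_of_all _ fun x => norm_ambiguity_le ψ _ _)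
  exact ((continuous_ambiguity ψ).comp (by fun_prop :
    Continuous fun x : (ι → ℝ) × (ι → ℝ) =>
      (p + (2 * r) • x.2, q + (2 * r) • x.1))).aestronglyMeasurable

/-- The cutoff in `x.2` regularises the Fourier inversion which recovers the correlation, and the
cutoff in `x.1` smooths the Fourier integral of the latter. -/
theorem integral_gauss_mul_wignerIntegral {r : ℝ} (hr : 0 < r) (p q : ι → ℝ) :
    ∫ x : (ι → ℝ) × (ι → ℝ), ((gauss r x.1 * gauss r x.2 : ℝ) : ℂ) *
        (phase p x.1 * phase (-q) x.2 * wignerIntegral ψ x.1 x.2)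
      = ∫ x : (ι → ℝ) × (ι → ℝ), ((gauss 1 x.1 * gauss 1 x.2 : ℝ) : ℂ) *
        ambiguity ψ (p + (2 * r) • x.2) (q + (2 * r) • x.1) := by
  have hq : -q = (2 : ℝ) • -((1 / 2 : ℝ) • q) := by module
  have hambiguity : ∀ z t, ambiguity ψ (p + (2 * r) • t) (q + (2 * r) • z) = fourierIntegral
      (fun s => correlation ψ s ((1 / 2 : ℝ) • q + r • z)) (p + (2 * r) • t) := fun z t => by
    rw [ambiguity, show (1 / 2 : ℝ) • (q + (2 * r) • z) = (1 / 2 : ℝ) • q + r • z by module]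
  calc ∫ x : (ι → ℝ) × (ι → ℝ), ((gauss r x.1 * gauss r x.2 : ℝ) : ℂ) *
        (phase p x.1 * phase (-q) x.2 * wignerIntegral ψ x.1 x.2)
      = ∫ s, gauss r s * (phase p s *
          ∫ t, gauss r t * (phase (-q) t * wignerIntegral ψ s t)) := by
        rw [Measure.volume_eq_prod, integral_prod _ (integrable_gauss_mul_wignerIntegral ψ hr p q)]
        simp only [← integral_const_mul, Complex.ofReal_mul]
        congr! 4
        ring
    _ = (√Real.pi ^ Fintype.card ι : ℝ) * ∫ s, ∫ z, gauss 1 z * (gauss r s *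
          (phase p s * correlation ψ s ((1 / 2 : ℝ) • q + r • z))) := by
        simp only [wignerIntegral, hq, integral_gauss_mul_phase_mul_fourierIntegral
          (integrable_correlation_right ψ _) hr, ← integral_const_mul]
        congr! 4
        ring
    _ = ∫ z, gauss 1 z * ∫ t, gauss 1 t *
          ambiguity ψ (p + (2 * r) • t) (q + (2 * r) • z) := by
        rw [integral_integral_swap
          (integrable_gauss_mul_gauss_mul_phase_mul_correlation ψ r p _), ← integral_const_mul]
        simp only [integral_const_mul, mul_left_comm _ (gauss 1 _ : ℂ), hambiguity,
          integral_gauss_mul_phase_mul (integrable_correlation_left ψ _)]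
    _ = _ := by
        rw [Measure.volume_eq_prod, integral_prod _ (integrable_gauss_mul_ambiguity ψ r p q)]
        simp only [← integral_const_mul, Complex.ofReal_mul, mul_assoc]

end GaussianCutoff

section PhaseSpace

variable {M : ℕ} {F : Type*} [NormedAddCommGroup F]

/-- The canonical coordinates `(√2 Re α, √2 Im α)` (position and momentum) of a point of phase
space. -/
def quadratures : (Fin M → ℂ) →ₗ[ℝ] (Fin M → ℝ) × (Fin M → ℝ) where
  toFun α := (fun m => √2 * (α m).re, fun m => √2 * (α m).im)
  map_add' α β := by
    ext m <;> simp [mul_add]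
  map_smul' c α := by
    ext m <;> simp [mul_left_comm]

@[fun_prop]
theorem continuous_quadratures : Continuous (quadratures (M := M)) :=
  quadratures.continuous_of_finiteDimensional

/-- The identification of `ℂ^M` with `ℝ^M × ℝ^M` by real and imaginary parts. -/
def reImEquiv (M : ℕ) : (Fin M → ℂ) ≃ᵐ (Fin M → ℝ) × (Fin M → ℝ) :=
  (MeasurableEquiv.piCongrRight fun _ => Complex.measurableEquivRealProd).trans
    (MeasurableEquiv.arrowProdEquivProdArrow ℝ ℝ (Fin M))

theorem measurePreserving_reImEquiv : MeasurePreserving (reImEquiv M) :=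
  (volume_measurePreserving_arrowProdEquivProdArrow ℝ ℝ (Fin M)).comp
    (volume_preserving_pi fun _ => Complex.volume_preserving_equiv_real_prod)

theorem quadratures_eq_smul_reImEquiv (α : Fin M → ℂ) : quadratures α = √2 • reImEquiv M α := rfl

instance isAddHaarMeasure_volume_prod :
    (volume : Measure ((Fin M → ℝ) × (Fin M → ℝ))).IsAddHaarMeasure :=
  Measure.prod.instIsAddHaarMeasure volume volume

theorem integrable_comp_quadratures {f : (Fin M → ℝ) × (Fin M → ℝ) → F} (hf : Integrable f) :
    Integrable fun α => f (quadratures α) :=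
  measurePreserving_reImEquiv.integrable_comp_of_integrable
    (hf.comp_smul (Real.sqrt_ne_zero'.2 two_pos))

theorem integral_comp_quadratures [NormedSpace ℝ F] (f : (Fin M → ℝ) × (Fin M → ℝ) → F) :
    ∫ α, f (quadratures α) = ((2 : ℝ) ^ M)⁻¹ • ∫ x, f x := by
  simp only [quadratures_eq_smul_reImEquiv]
  rw [measurePreserving_reImEquiv.integral_comp (reImEquiv M).measurableEmbedding
      (fun x => f (√2 • x)),
    Measure.integral_comp_smul_of_nonneg _ f √2 (hR := Real.sqrt_nonneg 2), Module.finrank_prod,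
    Module.finrank_fin_fun, ← two_mul, pow_mul, Real.sq_sqrt zero_le_two]

/-- The Gaussian cutoff of width `1 / r` on phase space. -/
def regulator (r : ℝ) (α : Fin M → ℂ) : ℝ := gauss r (quadratures α).1 * gauss r (quadratures α).2

theorem regulator_pos (r : ℝ) (α : Fin M → ℂ) : 0 < regulator r α :=
  mul_pos (gauss_pos _ _) (gauss_pos _ _)

theorem regulator_le_one (r : ℝ) (α : Fin M → ℂ) : regulator r α ≤ 1 :=
  mul_le_one₀ (gauss_le_one _ _) (gauss_pos _ _).le (gauss_le_one _ _)

theorem integrable_regulator {r : ℝ} (hr : 0 < r) : Integrable fun α : Fin M → ℂ => regulator r α :=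
  integrable_comp_quadratures ((integrable_gauss hr).mul_prod (integrable_gauss hr))

theorem integral_regulator_one : ∫ α : Fin M → ℂ, regulator 1 α = (Real.pi / 2) ^ M := by
  have h := integral_comp_quadratures (M := M) fun x => gauss 1 x.1 * gauss 1 x.2
  rw [Measure.volume_eq_prod, integral_prod_mul, integral_gauss_one, ← mul_pow,
    Real.mul_self_sqrt Real.pi_pos.le, Fintype.card_fin, smul_eq_mul, ← inv_pow, ← mul_pow,
    inv_mul_eq_div] at h
  exact h

/-- The character `exp (∑ₘ ξₘ αₘ* - ξₘ* αₘ)` of phase space, i.e. the function whose Weyl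
quantisation is the displacement `D(ξ)`. -/
def weylChar (ξ α : Fin M → ℂ) : ℂ :=
  phase (quadratures ξ).2 (quadratures α).1 * phase (-(quadratures ξ).1) (quadratures α).2

theorem norm_weylChar (ξ α : Fin M → ℂ) : ‖weylChar ξ α‖ = 1 := by
  rw [weylChar, norm_mul, norm_phase, norm_phase, one_mul]

theorem weylChar_add (ξ η α : Fin M → ℂ) :
    weylChar (ξ + η) α = weylChar ξ α * weylChar η α := by
  simp only [weylChar, map_add, Prod.fst_add, Prod.snd_add, neg_add, phase_add]
  ring

theorem weylChar_sub (ξ η α : Fin M → ℂ) :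
    weylChar (ξ - η) α = weylChar ξ α * starRingEnd ℂ (weylChar η α) := by
  have h := weylChar_add (ξ - η) η α
  rw [sub_add_cancel] at h
  rw [h, mul_assoc, Complex.mul_conj', norm_weylChar, Complex.ofReal_one, one_pow, mul_one]

end PhaseSpace

section Displacement

variable {M : ℕ} (ψ : ModeSpace M)

theorem coeFn_displacement (ξ : Fin M → ℂ) : displacement ξ ψ =ᵐ[volume] displaceFun ξ ψ :=
  MemLp.coeFn_toLp (memLp_displaceFun ξ (Lp.memLp ψ))

theorem displacement_comp_neg (ξ : Fin M → ℂ) :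
    displacement ξ ∘L displacement (-ξ) = ContinuousLinearMap.id ℂ (ModeSpace M) := by
  ext1 ψ
  refine Lp.ext ?_
  have hcomp := (coeFn_displacement (displacement (-ξ) ψ) ξ).trans
    (displaceFun_congr ξ (coeFn_displacement ψ (-ξ)))
  refine hcomp.trans (ae_of_all _ fun x => ?_)
  have hgroup := congrFun (displaceFun_add ξ ψ 1 (-1)) x
  simp only [one_smul, neg_smul] at hgroup
  rw [← hgroup]
  simp [displaceFun, displacePhase, displaceShift, Pi.sub_def]

theorem adjoint_displacement (ξ : Fin M → ℂ) :
    ContinuousLinearMap.adjoint (displacement ξ) = displacement (-ξ) := by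
  have hiso : ContinuousLinearMap.adjoint (displacement ξ) ∘L displacement ξ
      = ContinuousLinearMap.id ℂ (ModeSpace M) :=
    (displacement ξ).norm_map_iff_adjoint_comp_self.1 (displacementIsometry ξ).norm_map
  calc ContinuousLinearMap.adjoint (displacement ξ)
      = ContinuousLinearMap.adjoint (displacement ξ) ∘L displacement ξ ∘L displacement (-ξ) := by
        rw [displacement_comp_neg, ContinuousLinearMap.comp_id]
    _ = displacement (-ξ) := by
        rw [← ContinuousLinearMap.comp_assoc, hiso, ContinuousLinearMap.id_comp]

theorem displaceShift_eq (ξ : Fin M → ℂ) : displaceShift ξ = (quadratures ξ).1 := rfl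

theorem displacePhase_eq_phase (ξ : Fin M → ℂ) (x : Fin M → ℝ) :
    displacePhase ξ x = phase (quadratures ξ).2 (x - (1 / 2 : ℝ) • (quadratures ξ).1) := by
  rw [displacePhase, phase, dotProduct]
  congr! 4 with m
  simp only [quadratures, LinearMap.coe_mk, AddHom.coe_mk, Pi.sub_apply, Pi.smul_apply, smul_eq_mul]
  linear_combination (1 / 2 * (ξ m).re * (ξ m).im) * Real.mul_self_sqrt zero_le_two

theorem inner_displacement (ξ : Fin M → ℂ) :
    inner ℂ ψ (displacement ξ ψ) = ambiguity ψ (quadratures ξ).2 (quadratures ξ).1 := by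
  set h := (1 / 2 : ℝ) • (quadratures ξ).1
  have hae := (measurePreserving_add_right volume h).quasiMeasurePreserving.ae_eq_comp
    (coeFn_displacement ψ ξ)
  rw [L2.inner_def, ← integral_add_right_eq_self _ h, ambiguity, fourierIntegral]
  refine integral_congr_ae ?_
  filter_upwards [hae] with s hs
  simp only [Function.comp_apply] at hs
  rw [hs, RCLike.inner_apply, displaceFun, correlation, displacePhase_eq_phase, displaceShift_eq,
    add_sub_cancel_right, show s + h - (quadratures ξ).1 = s - h by module]
  ring

/-- The displaced parity operator `D(α) Π D(α)†`. -/
def displacedParity (α : Fin M → ℂ) : ModeSpace M →L[ℂ] ModeSpace M :=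
  displacement α ∘L parity M ∘L ContinuousLinearMap.adjoint (displacement α)

theorem coeFn_displacedParity (α : Fin M → ℂ) : displacedParity α ψ =ᵐ[volume]
    displaceFun α fun x => displaceFun (-α) ψ (-x) := by
  rw [displacedParity, adjoint_displacement]
  refine (coeFn_displacement _ α).trans (displaceFun_congr α ?_)
  exact (Lp.coeFn_compMeasurePreserving (displacement (-α) ψ)
    (Measure.measurePreserving_neg volume)).trans
      ((Measure.measurePreserving_neg volume).quasiMeasurePreserving.ae_eq_comp
        (coeFn_displacement ψ (-α)))

theorem displaceFun_neg_displaceFun (α : Fin M → ℂ) (f : (Fin M → ℝ) → ℂ) (y : Fin M → ℝ) :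
    displaceFun α (fun x => displaceFun (-α) f (-x)) ((quadratures α).1 + y)
      = phase ((2 : ℝ) • (quadratures α).2) y * f ((quadratures α).1 - y) := by
  set q := (quadratures α).1
  set p := (quadratures α).2
  have hphase : phase p (q + y - (1 / 2 : ℝ) • q) * phase (-p) (-(q + y - q) - (1 / 2 : ℝ) • -q)
      = phase ((2 : ℝ) • p) y := by
    rw [← neg_one_smul ℝ p, phase_smul, phase_smul, phase_comm p, phase_comm p, phase_comm p,
      ← phase_add]
    congr 1
    module
  simp only [displaceFun, displaceShift_eq, displacePhase_eq_phase, map_neg, Prod.fst_neg,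
    Prod.snd_neg]
  rw [← mul_assoc, hphase, show -(q + y - q) - -q = q - y by abel]

theorem inner_displacedParity (α : Fin M → ℂ) :
    inner ℂ ψ (displacedParity α ψ) = wignerIntegral ψ (quadratures α).1 (quadratures α).2 := by
  have hae := (measurePreserving_add_left volume
    (quadratures α).1).quasiMeasurePreserving.ae_eq_comp (coeFn_displacedParity ψ α)
  rw [L2.inner_def, ← integral_add_left_eq_self _ (quadratures α).1, wignerIntegral,
    fourierIntegral]
  refine integral_congr_ae ?_
  filter_upwards [hae] with y hy
  simp only [Function.comp_apply] at hy
  rw [hy, RCLike.inner_apply, displaceFun_neg_displaceFun, correlation]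
  ring

theorem norm_inner_displacement_le (ξ : Fin M → ℂ) :
    ‖inner ℂ ψ (displacement ξ ψ)‖ ≤ ‖ψ‖ ^ 2 := by
  rw [inner_displacement]
  exact norm_ambiguity_le ψ _ _

theorem norm_weylChar_mul_inner_displacedParity_le (ξ α : Fin M → ℂ) :
    ‖weylChar ξ α * inner ℂ ψ (displacedParity α ψ)‖ ≤ ‖ψ‖ ^ 2 := by
  rw [norm_mul, norm_weylChar, one_mul, inner_displacedParity]
  exact norm_wignerIntegral_le ψ _ _

theorem continuous_inner_displacement : Continuous fun ξ => inner ℂ ψ (displacement ξ ψ) := by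
  simp only [inner_displacement]
  exact ((continuous_ambiguity ψ).comp (continuous_quadratures.snd.prodMk
    continuous_quadratures.fst)).congr fun ξ => rfl

theorem integrable_regulator_mul_inner_displacedParity {r : ℝ} (hr : 0 < r) (ξ : Fin M → ℂ) :
    Integrable fun α => (regulator r α : ℂ) *
      (weylChar ξ α * inner ℂ ψ (displacedParity α ψ)) := by
  simp only [inner_displacedParity]
  exact integrable_comp_quadratures
    (integrable_gauss_mul_wignerIntegral ψ hr (quadratures ξ).2 (quadratures ξ).1)

/-- Both sides carry the same Jacobian, so no normalisation constant appears. -/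
theorem integral_regulator_mul_inner_displacedParity {r : ℝ} (hr : 0 < r) (ξ : Fin M → ℂ) :
    ∫ α, (regulator r α : ℂ) * (weylChar ξ α * inner ℂ ψ (displacedParity α ψ))
      = ∫ β, (regulator 1 β : ℂ) * inner ℂ ψ (displacement (ξ + (2 * r) • β) ψ) := by
  have h := integral_gauss_mul_wignerIntegral ψ hr (quadratures ξ).2 (quadratures ξ).1
  have h' := congrArg (((2 : ℝ) ^ M)⁻¹ • ·) h
  simp only [← integral_comp_quadratures] at h'
  simp only [inner_displacedParity, inner_displacement, map_add, map_smul, Prod.fst_add,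
    Prod.snd_add, Prod.smul_fst, Prod.smul_snd]
  exact h'

end Displacement

section Integration

variable {X J : Type*} [MeasurableSpace X] {μ : Measure X} [Countable J] {g S : X → ℂ}
  {G : J → X → ℂ} {b : J → ℝ}

theorem hasSum_integral_mul (hg : Integrable g μ)
    (hG : ∀ i, AEStronglyMeasurable (fun x => g x * G i x) μ) (hGb : ∀ i x, ‖G i x‖ ≤ b i)
    (hb : Summable b) (hS : ∀ x, HasSum (fun i => G i x) (S x)) :
    HasSum (fun i => ∫ x, g x * G i x ∂μ) (∫ x, g x * S x ∂μ) := by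
  refine hasSum_integral_of_dominated_convergence (fun i x => ‖g x‖ * b i) hG
    (fun i => ae_of_all _ fun x => ?_) (ae_of_all _ fun x => hb.mul_left _) ?_
    (ae_of_all _ fun x => (hS x).mul_left _)
  · rw [norm_mul]
    exact mul_le_mul_of_nonneg_left (hGb i x) (norm_nonneg _)
  · simp only [tsum_mul_left]
    exact hg.norm.mul_const _

theorem integrable_mul_of_hasSum (hg : Integrable g μ)
    (hG : ∀ i, AEStronglyMeasurable (fun x => g x * G i x) μ) (hGb : ∀ i x, ‖G i x‖ ≤ b i)
    (hb : Summable b) (hS : ∀ x, HasSum (fun i => G i x) (S x)) :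
    Integrable (fun x => g x * S x) μ := by
  refine (hg.norm.mul_const (∑' i, b i)).mono' ?_ (ae_of_all _ fun x => ?_)
  · exact aestronglyMeasurable_of_tendsto_ae (Filter.atTop : Filter (Finset J))
      (fun s => Finset.aestronglyMeasurable_fun_sum s fun i _ => hG i)
      (ae_of_all _ fun x => (hS x).mul_left (g x))
  · rw [norm_mul, ← (hS x).tsum_eq]
    exact mul_le_mul_of_nonneg_left (tsum_of_norm_bounded hb.hasSum fun i => hGb i x)
      (norm_nonneg _)

end Integration

section Average

variable {V : Type*} [AddCommGroup V] [Module ℝ V] [TopologicalSpace V] [ContinuousAdd V]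
  [ContinuousSMul ℝ V] [MeasurableSpace V] [OpensMeasurableSpace V] {μ : Measure V}

theorem tendsto_integral_mul_comp_add_smul {φ F : V → ℂ} {C : ℝ} (hφ : Integrable φ μ)
    (hF : Continuous F) (hC : ∀ v, ‖F v‖ ≤ C) (x : V) :
    Filter.Tendsto (fun r : ℝ => ∫ v, φ v * F (x + r • v) ∂μ) (nhds 0)
      (nhds ((∫ v, φ v ∂μ) * F x)) := by
  rw [← integral_mul_const]
  refine tendsto_integral_filter_of_dominated_convergence (fun v => ‖φ v‖ * C)
    (Filter.Eventually.of_forall fun r => hφ.aestronglyMeasurable.mul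
      (by fun_prop : Continuous fun v => F (x + r • v)).aestronglyMeasurable)
    (Filter.Eventually.of_forall fun r => ae_of_all _ fun v => ?_) (hφ.norm.mul_const C)
    (ae_of_all _ fun v => ?_)
  · rw [norm_mul]
    exact mul_le_mul_of_nonneg_left (hC _) (norm_nonneg _)
  · have hcont : Continuous fun r : ℝ => φ v * F (x + r • v) := by fun_prop
    simpa only [zero_smul, add_zero] using hcont.tendsto 0

end Average

section CharacteristicFunction

variable {M : ℕ} {ρ : ModeSpace M →L[ℂ] ModeSpace M} {J : Type*} {ψ : J → ModeSpace M}

theorem IsEnsemble.norm_trace_displacement_le (hψ : IsEnsemble ρ ψ) (ξ : Fin M → ℂ) :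
    ‖trace (ρ ∘L displacement ξ)‖ ≤ ∑' i, ‖ψ i‖ ^ 2 := by
  rw [← (hψ.hasSum_inner _).tsum_eq]
  exact tsum_of_norm_bounded hψ.summable_norm_sq.hasSum
    fun i => norm_inner_displacement_le (ψ i) ξ

theorem IsEnsemble.continuous_trace_displacement (hψ : IsEnsemble ρ ψ) :
    Continuous fun ξ => trace (ρ ∘L displacement ξ) := by
  simp only [← fun ξ => (hψ.hasSum_inner (displacement ξ)).tsum_eq]
  exact continuous_tsum (fun i => continuous_inner_displacement (ψ i)) hψ.summable_norm_sq
    fun i ξ => norm_inner_displacement_le (ψ i) ξ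

variable [Countable J]

theorem IsEnsemble.integrable_regulator_mul_trace (hψ : IsEnsemble ρ ψ) {r : ℝ} (hr : 0 < r)
    (ξ : Fin M → ℂ) : Integrable fun α =>
      (regulator r α : ℂ) * (weylChar ξ α * trace (ρ ∘L displacedParity α)) :=
  integrable_mul_of_hasSum (integrable_regulator hr).ofReal
    (fun i => (integrable_regulator_mul_inner_displacedParity (ψ i) hr ξ).aestronglyMeasurable)
    (fun i α => norm_weylChar_mul_inner_displacedParity_le (ψ i) ξ α) hψ.summable_norm_sq
    fun α => (hψ.hasSum_inner (displacedParity α)).mul_left _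

theorem IsEnsemble.integral_regulator_mul_trace (hψ : IsEnsemble ρ ψ) {r : ℝ} (hr : 0 < r)
    (ξ : Fin M → ℂ) :
    ∫ α, (regulator r α : ℂ) * (weylChar ξ α * trace (ρ ∘L displacedParity α))
      = ∫ β, (regulator 1 β : ℂ) * trace (ρ ∘L displacement (ξ + (2 * r) • β)) := by
  have hparity := hasSum_integral_mul (integrable_regulator hr).ofReal
    (fun i => (integrable_regulator_mul_inner_displacedParity (ψ i) hr ξ).aestronglyMeasurable)
    (fun i α => norm_weylChar_mul_inner_displacedParity_le (ψ i) ξ α) hψ.summable_norm_sq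
    fun α => (hψ.hasSum_inner (displacedParity α)).mul_left _
  have hdisplacement := hasSum_integral_mul (integrable_regulator (M := M) one_pos).ofReal
    (G := fun i β => inner ℂ (ψ i) (displacement (ξ + (2 * r) • β) (ψ i)))
    (fun i => (integrable_regulator one_pos).ofReal.aestronglyMeasurable.mul
      ((continuous_inner_displacement (ψ i)).comp (by fun_prop)).aestronglyMeasurable)
    (fun i β => norm_inner_displacement_le (ψ i) _) hψ.summable_norm_sq
    fun β => hψ.hasSum_inner (displacement (ξ + (2 * r) • β))
  simp only [RCLike.ofReal_eq_complex_ofReal] at hparity hdisplacement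
  simp only [integral_regulator_mul_inner_displacedParity _ hr] at hparity
  exact hparity.unique hdisplacement

/-- The Fourier integral of the Wigner function, made absolutely convergent by a Gaussian cutoff of
width `1 / r`. -/
def regularizedCharFun (ρ : ModeSpace M →L[ℂ] ModeSpace M) (r : ℝ) (ξ : Fin M → ℂ) : ℂ :=
  ((2 / Real.pi) ^ M : ℝ) *
    ∫ α, (regulator r α : ℂ) * (weylChar ξ α * trace (ρ ∘L displacedParity α))

theorem IsEnsemble.tendsto_regularizedCharFun (hψ : IsEnsemble ρ ψ) (ξ : Fin M → ℂ) :
    Filter.Tendsto (fun r => regularizedCharFun ρ r ξ) (nhdsWithin 0 (Set.Ioi 0))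
      (nhds (trace (ρ ∘L displacement ξ))) := by
  have hmass : (((2 / Real.pi) ^ M : ℝ) : ℂ) * ∫ α : Fin M → ℂ, (regulator 1 α : ℂ) = 1 := by
    rw [integral_complex_ofReal, integral_regulator_one, ← Complex.ofReal_mul, ← mul_pow,
      div_mul_div_cancel₀ Real.pi_ne_zero, div_self two_ne_zero, one_pow, Complex.ofReal_one]
  have htwo : Filter.Tendsto (fun r : ℝ => 2 * r) (nhdsWithin 0 (Set.Ioi 0)) (nhds 0) :=
    ((continuous_const_mul (2 : ℝ)).tendsto' 0 0 (mul_zero 2)).mono_left nhdsWithin_le_nhds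
  have haverage := ((tendsto_integral_mul_comp_add_smul (integrable_regulator one_pos).ofReal
    hψ.continuous_trace_displacement hψ.norm_trace_displacement_le ξ).comp htwo).const_mul
      (((2 / Real.pi) ^ M : ℝ) : ℂ)
  simp only [RCLike.ofReal_eq_complex_ofReal] at haverage
  rw [← mul_assoc, hmass, one_mul] at haverage
  refine haverage.congr' ?_
  filter_upwards [self_mem_nhdsWithin] with r hr
  rw [regularizedCharFun, hψ.integral_regulator_mul_trace hr ξ, Function.comp_apply]

end CharacteristicFunction

section ToeplitzForm

variable {G κ : Type*} [Sub G] [Fintype κ]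

/-- The form `∑ u_j* u_k χ(ξ_j - ξ_k)`, whose nonnegativity for all `ξ` and `u` is positive
definiteness of `χ` in the sense of Bochner. -/
def toeplitzForm (χ : G → ℂ) (ξ : κ → G) (u : κ → ℂ) : ℂ :=
  ∑ j, ∑ k, star (u j) * u k * χ (ξ j - ξ k)

variable (ξ : κ → G) (u : κ → ℂ)

theorem toeplitzForm_const_mul (c : ℂ) (χ : G → ℂ) :
    toeplitzForm (fun x => c * χ x) ξ u = c * toeplitzForm χ ξ u := by
  simp only [toeplitzForm, Finset.mul_sum, mul_left_comm c]

theorem tendsto_toeplitzForm {T : Type*} {l : Filter T} {χ : T → G → ℂ} {χ₀ : G → ℂ}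
    (h : ∀ x, Filter.Tendsto (fun t => χ t x) l (nhds (χ₀ x))) :
    Filter.Tendsto (fun t => toeplitzForm (χ t) ξ u) l (nhds (toeplitzForm χ₀ ξ u)) :=
  tendsto_finsetSum _ fun _ _ => tendsto_finsetSum _ fun _ _ => (h _).const_mul _

variable {X : Type*} [MeasurableSpace X] {μ : Measure X} {f : X → G → ℂ}

theorem integrable_toeplitzForm (hf : ∀ x, Integrable (fun a => f a x) μ) :
    Integrable (fun a => toeplitzForm (f a) ξ u) μ :=
  integrable_finsetSum _ fun _ _ => integrable_finsetSum _ fun _ _ => (hf _).const_mul _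

theorem toeplitzForm_integral (hf : ∀ x, Integrable (fun a => f a x) μ) :
    toeplitzForm (fun x => ∫ a, f a x ∂μ) ξ u = ∫ a, toeplitzForm (f a) ξ u ∂μ := by
  simp only [toeplitzForm]
  rw [integral_finsetSum _ fun _ _ => integrable_finsetSum _ fun _ _ => (hf _).const_mul _]
  simp only [integral_finsetSum _ fun _ _ => (hf _).const_mul _, integral_const_mul]

end ToeplitzForm

section TrigWeight

variable {M : ℕ} {κ : Type*} [Fintype κ] (Ξ : κ → Fin M → ℂ) (u : κ → ℂ)

/-- The squared modulus of the trigonometric polynomial with frequencies `Ξ` and coefficients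
`star u` on phase space. -/
def trigWeight (α : Fin M → ℂ) : ℝ := ‖∑ j, star (u j) * weylChar (Ξ j) α‖ ^ 2

theorem trigWeight_nonneg (α : Fin M → ℂ) : 0 ≤ trigWeight Ξ u α := sq_nonneg _

theorem toeplitzForm_weylChar (α : Fin M → ℂ) :
    toeplitzForm (fun ξ => weylChar ξ α) Ξ u = trigWeight Ξ u α := by
  rw [trigWeight, Complex.ofReal_pow, ← Complex.mul_conj', map_sum, Finset.sum_mul_sum,
    toeplitzForm]
  refine Finset.sum_congr rfl fun j _ => Finset.sum_congr rfl fun k _ => ?_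
  rw [weylChar_sub, map_mul, starRingEnd_apply, starRingEnd_apply, star_star]
  ring

theorem trigWeight_le (α : Fin M → ℂ) :
    trigWeight Ξ u α ≤ Fintype.card κ * ∑ j, ‖u j‖ ^ 2 := by
  have htriangle : ‖∑ j, star (u j) * weylChar (Ξ j) α‖ ≤ ∑ j, ‖u j‖ := by
    refine (norm_sum_le _ _).trans_eq (Finset.sum_congr rfl fun j _ => ?_)
    rw [norm_mul, norm_weylChar, mul_one, norm_star]
  exact (pow_le_pow_left₀ (norm_nonneg _) htriangle 2).trans sq_sum_le_card_mul_sum_sq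

end TrigWeight

section NegativityVolume

variable {M : ℕ} {κ : Type*} [Fintype κ] {ρ : ModeSpace M →L[ℂ] ModeSpace M}

theorem negativityVolume_eq_lintegral_neg (ρ : ModeSpace M →L[ℂ] ModeSpace M) :
    negativityVolume ρ = ∫⁻ α, ENNReal.ofReal (-wigner ρ α) := by
  have htwo : ∀ w : ℝ, ENNReal.ofReal (|w| - w) = 2 * ENNReal.ofReal (-w) := fun w => by
    rw [← ENNReal.ofReal_ofNat, ← ENNReal.ofReal_mul zero_le_two]
    rcases le_total 0 w with hw | hw
    · rw [abs_of_nonneg hw, sub_self, ENNReal.ofReal_zero, ENNReal.ofReal_of_nonpos (by linarith)]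
    · rw [abs_of_nonpos hw]
      congr 1
      ring
  simp only [negativityVolume, htwo]
  rw [lintegral_const_mul' _ _ ENNReal.ofNat_ne_top, ← mul_assoc, one_div,
    ENNReal.inv_mul_cancel two_ne_zero ENNReal.ofNat_ne_top, one_mul]

theorem neg_mul_lintegral_neg_le_integral_mul {X : Type*} [MeasurableSpace X] {μ : Measure X}
    {h f : X → ℝ} {K : ℝ} (hK : 0 ≤ K) (h_nonneg : ∀ x, 0 ≤ h x) (h_le : ∀ x, h x ≤ K)
    (hint : Integrable (fun x => h x * f x) μ)
    (hf : ∫⁻ x, ENNReal.ofReal (-f x) ∂μ ≠ ∞) :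
    -(K * (∫⁻ x, ENNReal.ofReal (-f x) ∂μ).toReal) ≤ ∫ x, h x * f x ∂μ := by
  have hneg : ∫⁻ x, ENNReal.ofReal (-(h x * f x)) ∂μ
      ≤ ENNReal.ofReal K * ∫⁻ x, ENNReal.ofReal (-f x) ∂μ := by
    rw [← lintegral_const_mul' _ _ ENNReal.ofReal_ne_top]
    refine lintegral_mono fun x => ?_
    rw [← mul_neg, ENNReal.ofReal_mul (h_nonneg x)]
    gcongr
    exact h_le x
  have hneg_toReal := ENNReal.toReal_mono (ENNReal.mul_ne_top ENNReal.ofReal_ne_top hf) hneg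
  rw [ENNReal.toReal_mul, ENNReal.toReal_ofReal hK] at hneg_toReal
  rw [integral_eq_lintegral_pos_part_sub_lintegral_neg_part hint]
  linarith [ENNReal.toReal_nonneg (a := ∫⁻ x, ENNReal.ofReal (h x * f x) ∂μ)]

theorem wigner_eq (ρ : ModeSpace M →L[ℂ] ModeSpace M) (α : Fin M → ℂ) :
    wigner ρ α = (2 / Real.pi) ^ M * (trace (ρ ∘L displacedParity α)).re := rfl

theorem re_toeplitzForm_regularized_wigner (ρ : ModeSpace M →L[ℂ] ModeSpace M) (r : ℝ)
    (Ξ : κ → Fin M → ℂ) (u : κ → ℂ) (α : Fin M → ℂ) :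
    (toeplitzForm (fun ξ => (((2 / Real.pi) ^ M : ℝ) : ℂ) * ((regulator r α : ℂ) *
      (weylChar ξ α * trace (ρ ∘L displacedParity α)))) Ξ u).re
      = regulator r α * trigWeight Ξ u α * wigner ρ α := by
  have hfactor : ∀ ξ, (((2 / Real.pi) ^ M : ℝ) : ℂ) * ((regulator r α : ℂ) *
      (weylChar ξ α * trace (ρ ∘L displacedParity α))) = (((2 / Real.pi) ^ M : ℝ) : ℂ) *
        ((regulator r α : ℂ) * trace (ρ ∘L displacedParity α)) * weylChar ξ α := fun ξ => by
    ring
  simp only [hfactor]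
  rw [toeplitzForm_const_mul, toeplitzForm_weylChar, Complex.re_mul_ofReal, Complex.re_ofReal_mul,
    Complex.re_ofReal_mul, wigner_eq]
  ring

variable {J : Type*} [Countable J] {ψ : J → ModeSpace M}

theorem IsEnsemble.integrable_regulator_mul_trigWeight_mul_wigner (hψ : IsEnsemble ρ ψ) {r : ℝ}
    (hr : 0 < r) (Ξ : κ → Fin M → ℂ) (u : κ → ℂ) :
    Integrable fun α => regulator r α * trigWeight Ξ u α * wigner ρ α := by
  simp only [← re_toeplitzForm_regularized_wigner]
  exact (integrable_toeplitzForm Ξ u fun ξ =>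
    (hψ.integrable_regulator_mul_trace hr ξ).const_mul _).re

theorem IsEnsemble.re_toeplitzForm_regularizedCharFun (hψ : IsEnsemble ρ ψ) {r : ℝ} (hr : 0 < r)
    (Ξ : κ → Fin M → ℂ) (u : κ → ℂ) :
    (toeplitzForm (regularizedCharFun ρ r) Ξ u).re
      = ∫ α, regulator r α * trigWeight Ξ u α * wigner ρ α := by
  have hint := fun ξ => (hψ.integrable_regulator_mul_trace hr ξ).const_mul
    (((2 / Real.pi) ^ M : ℝ) : ℂ)
  have hform := toeplitzForm_integral Ξ u hint
  simp only [integral_const_mul] at hform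
  have hre := integral_re (integrable_toeplitzForm Ξ u hint)
  simp only [RCLike.re_eq_complex_re, re_toeplitzForm_regularized_wigner] at hre
  rw [hre, ← hform]
  rfl

theorem IsEnsemble.neg_negativityVolume_le_re_toeplitzForm (hψ : IsEnsemble ρ ψ)
    (hV : negativityVolume ρ ≠ ∞) (Ξ : κ → Fin M → ℂ) (u : κ → ℂ) :
    -((Fintype.card κ * ∑ j, ‖u j‖ ^ 2) * (negativityVolume ρ).toReal)
      ≤ (toeplitzForm (fun ξ => trace (ρ ∘L displacement ξ)) Ξ u).re := by
  have hlim := (Complex.continuous_re.tendsto _).comp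
    (tendsto_toeplitzForm Ξ u hψ.tendsto_regularizedCharFun)
  refine ge_of_tendsto hlim ?_
  filter_upwards [self_mem_nhdsWithin] with r hr
  rw [Function.comp_apply, hψ.re_toeplitzForm_regularizedCharFun hr]
  rw [negativityVolume_eq_lintegral_neg] at hV ⊢
  exact neg_mul_lintegral_neg_le_integral_mul (by positivity)
    (fun α => mul_nonneg (regulator_pos r α).le (trigWeight_nonneg Ξ u α))
    (fun α => (mul_le_of_le_one_left (trigWeight_nonneg Ξ u α) (regulator_le_one r α)).trans
      (trigWeight_le Ξ u α))
    (hψ.integrable_regulator_mul_trigWeight_mul_wigner hr Ξ u) hV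

end NegativityVolume

section Eigenvalues

variable {M N : ℕ} {ρ : ModeSpace M →L[ℂ] ModeSpace M} {J : Type*} {ψ : J → ModeSpace M}

theorem isLeast_smallestEigenvalue (hN : 0 < N) {C : Matrix (Fin N) (Fin N) ℂ}
    (hC : C.IsHermitian) : IsLeast (realEigenvalues C) (smallestEigenvalue C) := by
  have hfinite : (realEigenvalues C).Finite :=
    (Module.End.finite_hasEigenvalue (Matrix.toLin' C)).preimage Complex.ofReal_injective.injOn
  have hnonempty : (realEigenvalues C).Nonempty := by
    refine ⟨hC.eigenvalues ⟨0, hN⟩, ?_⟩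
    rw [realEigenvalues, Set.mem_ofPred_eq, Module.End.hasEigenvalue_iff_mem_spectrum,
      Matrix.spectrum_toLin']
    exact spectrum.algebraMap_mem ℂ (hC.eigenvalues_mem_spectrum_real ⟨0, hN⟩)
  exact ⟨hnonempty.csInf_mem hfinite, fun μ hμ => csInf_le hfinite.bddBelow hμ⟩

theorem IsEnsemble.isHermitian_charMatrix (hψ : IsEnsemble ρ ψ) (Ξ : Fin N → Fin M → ℂ) :
    (charMatrix ρ Ξ).IsHermitian := by
  ext j k
  simp only [Matrix.conjTranspose_apply, charMatrix, Matrix.of_apply, star_mul', hψ.star_trace,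
    adjoint_displacement, neg_sub, star_div₀, star_one, star_natCast]

theorem toeplitzForm_eq_star_dotProduct_charMatrix_mulVec
    (ρ : ModeSpace M →L[ℂ] ModeSpace M) (Ξ : Fin N → Fin M → ℂ) (u : Fin N → ℂ) :
    toeplitzForm (fun ξ => trace (ρ ∘L displacement ξ)) Ξ u
      = N * (star u ⬝ᵥ (charMatrix ρ Ξ).mulVec u) := by
  simp only [toeplitzForm, charMatrix, dotProduct, Matrix.mulVec, Matrix.of_apply, Finset.mul_sum,
    Pi.star_apply]
  congr! 2 with j _ k
  have hN : (N : ℂ) ≠ 0 := Nat.cast_ne_zero.2 j.pos.ne'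
  field_simp

theorem IsEnsemble.neg_negativityVolume_le_of_mem_realEigenvalues [Countable J]
    (hψ : IsEnsemble ρ ψ) (hV : negativityVolume ρ ≠ ∞) (Ξ : Fin N → Fin M → ℂ) {μ : ℝ}
    (hμ : μ ∈ realEigenvalues (charMatrix ρ Ξ)) : -(negativityVolume ρ).toReal ≤ μ := by
  obtain ⟨u, hu, hu₀⟩ := Module.End.HasEigenvalue.exists_hasEigenvector hμ
  rw [Module.End.mem_eigenspace_iff, Matrix.toLin'_apply] at hu
  obtain ⟨j, hj⟩ := Function.ne_iff.1 hu₀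
  have hnorm : 0 < ∑ j, ‖u j‖ ^ 2 := Finset.sum_pos' (fun k _ => sq_nonneg _)
    ⟨j, Finset.mem_univ j, pow_pos (norm_pos_iff.2 hj) 2⟩
  have hform : toeplitzForm (fun ξ => trace (ρ ∘L displacement ξ)) Ξ u
      = ((N * (∑ j, ‖u j‖ ^ 2) * μ : ℝ) : ℂ) := by
    have hself : star u ⬝ᵥ u = ((∑ j, ‖u j‖ ^ 2 : ℝ) : ℂ) := by
      simp only [dotProduct, Pi.star_apply, ← starRingEnd_apply, Complex.conj_mul',
        Complex.ofReal_sum, Complex.ofReal_pow]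
    rw [toeplitzForm_eq_star_dotProduct_charMatrix_mulVec, hu, dotProduct_smul, hself,
      smul_eq_mul]
    push_cast
    ring
  have hbound := hψ.neg_negativityVolume_le_re_toeplitzForm hV Ξ u
  rw [hform, Complex.ofReal_re, ← mul_neg, Fintype.card_fin] at hbound
  exact le_of_mul_le_mul_left hbound (mul_pos (Nat.cast_pos.2 j.pos) hnorm)

end Eigenvalues

end WignerNeg

end

theorem theorem1_general {M N : ℕ} (hN : 0 < N)
    (ρ : WignerNeg.ModeSpace M →L[ℂ] WignerNeg.ModeSpace M) (hρ : ρ.IsPositive)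
    (htr : Summable fun i => inner ℂ (WignerNeg.basis (WignerNeg.ModeSpace M) i)
      (ρ (WignerNeg.basis (WignerNeg.ModeSpace M) i)))
    (Ξ : Fin N → Fin M → ℂ) :
    (WignerNeg.charMatrix ρ Ξ).IsHermitian ∧
      IsLeast (WignerNeg.realEigenvalues (WignerNeg.charMatrix ρ Ξ))
        (WignerNeg.smallestEigenvalue (WignerNeg.charMatrix ρ Ξ)) ∧
      ENNReal.ofReal (WignerNeg.witness ρ Ξ) ≤ WignerNeg.negativityVolume ρ := by
  obtain ⟨J, ψ, hJ, hψ⟩ := WignerNeg.exists_isEnsemble hρ htr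
  have hHermitian := hψ.isHermitian_charMatrix Ξ
  have hleast := WignerNeg.isLeast_smallestEigenvalue hN hHermitian
  refine ⟨hHermitian, hleast, ?_⟩
  rcases eq_or_ne (WignerNeg.negativityVolume ρ) ∞ with hV | hV
  · exact le_top.trans_eq hV.symm
  · have hbound := hψ.neg_negativityVolume_le_of_mem_realEigenvalues hV Ξ hleast.1
    exact ENNReal.ofReal_le_of_le_toReal (max_le ENNReal.toReal_nonneg (neg_le.1 hbound))

theorem theorem1 {M N : ℕ} (hN : 0 < N)
    (ρ : WignerNeg.ModeSpace M →L[ℂ] WignerNeg.ModeSpace M)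
    (hρ : WignerNeg.IsDensityOperator ρ) (Ξ : Fin N → Fin M → ℂ) :
    (WignerNeg.charMatrix ρ Ξ).IsHermitian ∧
      IsLeast (WignerNeg.realEigenvalues (WignerNeg.charMatrix ρ Ξ))
        (WignerNeg.smallestEigenvalue (WignerNeg.charMatrix ρ Ξ)) ∧
      ENNReal.ofReal (WignerNeg.witness ρ Ξ) ≤ WignerNeg.negativityVolume ρ := by
  exact theorem1_general hN ρ hρ.isPositive hρ.hasSum_trace.summable Ξ
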